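/- All graphs are finite and simple. Let $d\ge 2$ and let $C_2\in O(\mathbb{R}^d)$ be a half-turn, i.e. the rotation by $\pi$ about a $(d-2)$-dimensional linear subspace $F$ (so $C_2=\mathrm{id}$ on $F$ and $C_2=-\mathrm{id}$ on $F^\perp$); put $\mathcal{C}_2=\{\mathrm{Id},C_2\}$. Let $G$ be a graph with $|E(G)|=d|V(G)|-\binom{d+1}{2}$ and let $\Phi:\mathcal{C}_2\to\mathrm{Aut}(G)$ be a homomorphism. Let $j_{C_2}$ be the number of vertices $i$ with $\Phi(C_2)(i)=i$, and let $b_{C_2}$ be the number of edges $\{i,j\}$ of $G$ with $\{\Phi(C_2)(i),\Phi(C_2)(j)\}=\{i,j\}$. Let $X$ be the linear space of all $q:V(G)\to\mathbb{R}^d$ with $x(q_i)=q_{\Phi(x)(i)}$ for all $i\in V(G)$ and $x\in\mathcal{C}_2$, and let $\mathscr{R}_{(G,\mathcal{C}_2,\Phi)}$ be the set of all injective $p\in X$. For a graph $H$ on $V(G)$, the rigidity matrix $\mathbf{R}(H,p)$ has one row for each edge and $d$ columns for each vertex; the row of $\{i,j\}$ has the entries of $p_i-p_j$ in the columns of $i$,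 those of $p_j-p_i$ in the columns of $j$, and $0$ elsewhere. A realization $p\in\mathscr{R}_{(G,\mathcal{C}_2,\Phi)}$ is called $(\mathcal{C}_2,\Phi)$-generic if a minor (determinant of a square submatrix) of $\mathbf{R}(K,p)$, where $K$ is the complete graph on $V(G)$, is zero only if the corresponding minor of $\mathbf{R}(K,q)$ is zero for all $q\in X$. A symmetry-preserving mechanism of $(G,p)$ is a continuous path $t\mapsto p(t)\in\mathscr{R}_{(G,\mathcal{C}_2,\Phi)}$, $t\in[0,1]$, with $p(0)=p$, such that $\|p(t)_i-p(t)_j\|=\|p_i-p_j\|$ for all $t$ and all $\{i,j\}\in E(G)$, and such that for some pair $k,l$ of vertices $\|p(t)_k-p(t)_l\|\ne\|p_k-p_l\|$ for all $0<t\le 1$. Then: (i) If $d=4$ and $b_{C_2}=0$, then every $(\mathcal{C}_2,\Phi)$-generic realization of $G$ has a symmetry-preserving mechanism. (ii) If $d>4$ and $j_{C_2}>\dfrac{b_{C_2}}{d-4}+\dfrac{d(d-7)+8}{2(d-4)}$, then every $(\mathcal{C}_2,\Phi)$-generic realization of $G$ has a symmetry-preserving mechanism. -/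

import Mathlib

namespace SymFramework

/-- Euclidean `d`-space. -/
abbrev Space (d : ℕ) : Type := EuclideanSpace ℝ (Fin d)

/-- The orthogonal group of `d`-space; symmetry groups are its subgroups. -/
abbrev Orth (d : ℕ) : Type := Space d ≃ₗᵢ[ℝ] Space d

/-- `h` is a half-turn: the rotation by the angle `π` about a `(d-2)`-dimensional linear
subspace `F`. It fixes `F` pointwise and acts as `-1` on the plane orthogonal to `F`. -/
def IsHalfTurn {d : ℕ} (h : Orth d) : Prop :=
  ∃ F : Submodule ℝ (Space d), Module.finrank ℝ F + 2 = d ∧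
    (∀ x ∈ F, h x = x) ∧ (∀ x ∈ Fᗮ, h x = -x)

/-- The symmetry group `{Id, h}` generated by a half-turn `h`. -/
noncomputable abbrev halfTurnGroup {d : ℕ} (h : Orth d) : Subgroup (Orth d) := Subgroup.zpowers h

/-- The half-turn `h` as an element of the group that it generates. -/
noncomputable def halfTurn {d : ℕ} (h : Orth d) : halfTurnGroup h := ⟨h, Subgroup.mem_zpowers h⟩

section

variable {V : Type*} {d : ℕ}

/-- The number of vertices (joints) fixed by the symmetry operation `x`. -/
noncomputable def fixedJoints {G : SimpleGraph V} {S : Subgroup (Orth d)} (Φ : S →* (G ≃g G))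
    (x : S) : ℕ :=
  {i : V | Φ x i = i}.ncard

/-- The number of edges (bars) fixed by the symmetry operation `x`: those whose two end-vertices
are either both fixed or swapped by `x`. -/
noncomputable def fixedBars {G : SimpleGraph V} {S : Subgroup (Orth d)} (Φ : S →* (G ≃g G))
    (x : S) : ℕ :=
  {e ∈ G.edgeSet | Sym2.map (Φ x) e = e}.ncard

/-- The linear space of all configurations satisfying the symmetry constraints given by `S`
and `Φ` (coinciding points are allowed). -/
def symConfigs {G : SimpleGraph V} {S : Subgroup (Orth d)} (Φ : S →* (G ≃g G)) :
    Set (V → Space d) :=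
  {p | ∀ (x : S) (i : V), (x : Orth d) (p i) = p (Φ x i)}

/-- The (injective) realizations of `G` with symmetry group `S` and of type `Φ`. -/
def symRealizations {G : SimpleGraph V} {S : Subgroup (Orth d)} (Φ : S →* (G ≃g G)) :
    Set (V → Space d) :=
  {p | Function.Injective p ∧ p ∈ symConfigs Φ}

/-- The rigidity matrix of `(G, p)`: the row of the edge `{i, j}` has the entries of `p i - p j`
in the columns of `i`, the entries of `p j - p i` in the columns of `j`, and `0` elsewhere. -/
noncomputable def rigidityMatrix [DecidableEq V] (G : SimpleGraph V) (p : V → Space d) :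
    Matrix G.edgeSet (V × Fin d) ℝ :=
  Matrix.of fun e vk => Sym2.lift
    ⟨fun i j => ((if vk.1 = i then 1 else 0) - (if vk.1 = j then 1 else 0)) *
      (p i vk.2 - p j vk.2), fun i j => by ring⟩ (e : Sym2 V)

/-- `(S, Φ)`-generic realizations: a minor of the rigidity matrix of the complete graph on `V`
at `p` vanishes only if this minor, as a polynomial function on the space of all configurations
satisfying the symmetry constraints, vanishes identically. -/
def IsSymGeneric [DecidableEq V] {G : SimpleGraph V} {S : Subgroup (Orth d)}
    (Φ : S →* (G ≃g G)) (p : V → Space d) : Prop :=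
  p ∈ symRealizations Φ ∧
    ∀ (m : ℕ) (r : Fin m → (⊤ : SimpleGraph V).edgeSet) (c : Fin m → V × Fin d),
      ((rigidityMatrix ⊤ p).submatrix r c).det = 0 →
        ∀ q ∈ symConfigs Φ, ((rigidityMatrix ⊤ q).submatrix r c).det = 0

/-- `γ` is a finite flex (mechanism) of `(G, p)`. -/
structure IsFiniteFlex (G : SimpleGraph V) (p : V → Space d) (γ : unitInterval → V → Space d) :
    Prop where
  continuous : Continuous γ
  start : γ 0 = p
  preserves_bars : ∀ (t : unitInterval) (i j : V), G.Adj i j → ‖γ t i - γ t j‖ = ‖p i - p j‖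
  nontrivial : ∃ k l : V, ∀ t : unitInterval, 0 < t → ‖γ t k - γ t l‖ ≠ ‖p k - p l‖

/-- `(G, p)` has a finite flex which preserves the symmetry given by `S` and `Φ` throughout
the path. -/
def HasSymmetryPreservingMechanism {G : SimpleGraph V} {S : Subgroup (Orth d)}
    (Φ : S →* (G ≃g G)) (p : V → Space d) : Prop :=
  ∃ γ : unitInterval → V → Space d, IsFiniteFlex G p γ ∧ ∀ t, γ t ∈ symRealizations Φ

end

end SymFramework

/-! The proof counts symmetric degrees of freedom. Put n = |V(G)|, j = `fixedJoints`, b =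
`fixedBars`. A symmetric velocity assignment has a component in the axis `F` for each vertex orbit
and one in `Fᗮ` for each orbit of size two, so these form a space of dimension (d-2)(n+j)/2 + (n-j).
It is subject to one equation per edge orbit, hence to (|E|+b)/2 equations. Symmetric rigid motions
contribute at most (d-2) + C(d-2,2) + 1. Under either hypothesis the balance is positive, so some
symmetric infinitesimal motion of G changes a distance.

Genericity makes that motion finite. A generic `p` maximizes the rank of the rigidity matrix over
symmetric configurations, so the kernel varies smoothly near `p` and can be followed by an ODE
inside the symmetric space (`exists_curve_mem_ker_of_rank_le`).

The bound on rigid motions must hold at `p` for any number of vertices, even if the points do not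
span. An explicit configuration `q` attains it (`exists_symmetric_rank_ge`), and maximality of rank
transfers it to `p` (`finrank_range_comp_le_of_maximal`). -/

/-! ### Integrating kernel vectors at points of maximal rank -/

open Set Filter Topology Module in
/-- Through a point at which a linear family of linear maps `B q` has maximal rank there is a curve
with any given initial velocity in the kernel, all of whose velocities stay in the kernel. The
curve remains in the fixed space of a projection `P` compatible with the family. -/
theorem exists_curve_mem_ker_of_rank_le {U L : Type*}
    [NormedAddCommGroup U] [NormedSpace ℝ U] [FiniteDimensional ℝ U]
    [NormedAddCommGroup L] [NormedSpace ℝ L] [FiniteDimensional ℝ L]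
    (B : U →L[ℝ] U →L[ℝ] L) (P : U →L[ℝ] U) (hP : ∀ u, P (P u) = P u) {p w : U}
    (hp : P p = p) (hw : P w = w)
    (hBP : ∀ q u, P q = q → B q u = 0 → B q (P u) = 0)
    (hrank : ∀ q, P q = q →
      finrank ℝ (LinearMap.range (B q : U →ₗ[ℝ] L)) ≤ finrank ℝ (LinearMap.range (B p : U →ₗ[ℝ] L)))
    (hpw : B p w = 0) :
    ∃ ε > (0 : ℝ), ∃ γ : ℝ → U, γ 0 = p ∧ HasDerivAt γ w 0 ∧
      ∀ t ∈ Ioo (-ε) ε, P (γ t) = γ t ∧ ∃ u, HasDerivAt γ u t ∧ B (γ t) u = 0 := by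
  have : CompleteSpace U := FiniteDimensional.complete ℝ U
  set R := LinearMap.range (B p : U →ₗ[ℝ] L) with hR
  have : CompleteSpace R := FiniteDimensional.complete ℝ R
  obtain ⟨π, hπ⟩ := R.subtype.exists_leftInverse_of_injective R.ker_subtype
  obtain ⟨M, hM⟩ := (B p : U →ₗ[ℝ] L).rangeRestrict.exists_rightInverse_of_surjective
    (LinearMap.range_rangeRestrict _)
  let πc : L →L[ℝ] R := LinearMap.toContinuousLinearMap π
  let Mc : R →L[ℝ] U := LinearMap.toContinuousLinearMap M
  let A : U → U →L[ℝ] R := fun q => πc.comp (B q)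
  let T : U → R →L[ℝ] R := fun q => (A q).comp Mc
  -- Since `T p = 1`, `T q` is invertible near `p`, and the correction term then moves `w` into the
  -- kernel of `A q`. Where `T q` is not invertible, `Ring.inverse` is 0; only a neighbourhood of
  -- `p` is used.
  let X : U → U := fun q => P (w - Mc (Ring.inverse (T q) (A q w)))
  have hTp : T p = 1 := by
    ext1 y
    have h1 : (B p : U →ₗ[ℝ] L).rangeRestrict (M y) = y := LinearMap.congr_fun hM y
    have h2 : B p (M y) = (y : L) := congrArg Subtype.val h1
    have h3 : π (y : L) = y := LinearMap.congr_fun hπ y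
    change π (B p (M y)) = y
    rw [h2, h3]
  have hA : ContDiff ℝ 1 A := contDiff_const.clm_comp B.contDiff
  have hT : ContDiff ℝ 1 T := hA.clm_comp contDiff_const
  have hX : ContDiffAt ℝ 1 X p := by
    have h1 : ContDiffAt ℝ 1 (fun q => Ring.inverse (T q)) p := by
      refine ContDiffAt.comp p (g := Ring.inverse) ?_ hT.contDiffAt
      rw [hTp]
      exact contDiffAt_ringInverse (R := R →L[ℝ] R) ℝ 1
    have h2 : ContDiffAt ℝ 1 (fun q => A q w) p := (hA.clm_apply contDiff_const).contDiffAt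
    have h3 := h1.clm_apply h2
    fun_prop
  have hXp : X p = w := by simp [X, A, hpw, hw]
  have hker : ∀ q, P q = q → IsUnit (T q) → B q (X q) = 0 := by
    intro q hq hu
    refine hBP q _ hq ?_
    have hAv : A q (w - Mc (Ring.inverse (T q) (A q w))) = 0 := by
      have h1 : T q (Ring.inverse (T q) (A q w)) = A q w := by
        rw [← mul_apply_eq_comp, Ring.mul_inverse_cancel _ hu]; rfl
      rw [map_sub, sub_eq_zero]
      exact h1.symm
    have hsurj : Function.Surjective (A q) := by
      intro y
      refine ⟨Mc (Ring.inverse (T q) y), ?_⟩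
      change T q (Ring.inverse (T q) y) = y
      rw [← mul_apply_eq_comp, Ring.mul_inverse_cancel _ hu]; rfl
    -- Maximality of the rank enters here: `A q` is onto `R`, so its kernel has codimension rank `B
    -- p`, at least that of the kernel of `B q`. The inclusion of kernels is therefore an equality.
    have hle : LinearMap.ker (B q : U →ₗ[ℝ] L) ≤ LinearMap.ker (A q : U →ₗ[ℝ] R) := by
      intro v hv
      have hv' : B q v = 0 := hv
      change πc (B q v) = 0
      rw [hv', map_zero]
    have heq := Submodule.eq_of_le_of_finrank_le hle (by
      have h1 := LinearMap.finrank_range_add_finrank_ker (B q : U →ₗ[ℝ] L)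
      have h2 := LinearMap.finrank_range_add_finrank_ker (A q : U →ₗ[ℝ] R)
      have h3 : finrank ℝ (LinearMap.range (A q : U →ₗ[ℝ] R)) = finrank ℝ R := by
        rw [LinearMap.range_eq_top.2 hsurj, finrank_top]
      have h4 := hrank q hq
      omega)
    have : w - Mc (Ring.inverse (T q) (A q w)) ∈ LinearMap.ker (B q : U →ₗ[ℝ] L) := by
      rw [heq]; exact hAv
    exact this
  obtain ⟨γ, hγ0, ε, hε, hγ⟩ :=
    hX.exists_forall_mem_closedBall_exists_eq_forall_mem_Ioo_hasDerivAt₀ 0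
  simp only [zero_sub, zero_add] at hγ
  have h0 : (0 : ℝ) ∈ Ioo (-ε) ε := ⟨by linarith, hε⟩
  -- The field `X` takes values in the fixed space of `P`, so `P (γ t) - γ t` is constant, and it
  -- vanishes at 0.
  have hfix : ∀ t ∈ Ioo (-ε) ε, P (γ t) = γ t := by
    intro t ht
    have hd : ∀ s ∈ Ioo (-ε) ε, HasDerivAt (fun s => P (γ s) - γ s) 0 s := by
      intro s hs
      have h1 := (P.hasFDerivAt.comp_hasDerivAt s (hγ s hs)).sub (hγ s hs)
      have h2 : P (X (γ s)) - X (γ s) = 0 := by simp only [X]; rw [hP, sub_self]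
      rw [h2] at h1
      exact h1
    have := isOpen_Ioo.is_const_of_deriv_eq_zero (isPreconnected_Ioo)
      (fun s hs => (hd s hs).differentiableAt.differentiableWithinAt)
      (fun s hs => (hd s hs).deriv) ht h0
    simp only [hγ0, hp, sub_self] at this
    exact sub_eq_zero.1 this
  have hcont : ContinuousAt γ 0 := (hγ 0 h0).continuousAt
  have hunit : ∀ᶠ t in 𝓝 (0 : ℝ), IsUnit (T (γ t)) := by
    have h1 : ContinuousAt (fun t => T (γ t)) 0 := hT.continuous.continuousAt.comp hcont
    have h2 : {x : R →L[ℝ] R | IsUnit x} ∈ 𝓝 (T (γ 0)) := by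
      refine (Units.isOpen (R := R →L[ℝ] R)).mem_nhds ?_
      rw [hγ0, hTp]; exact isUnit_one
    exact h1 h2
  obtain ⟨δ, hδ, hδu⟩ := Metric.eventually_nhds_iff.1 hunit
  refine ⟨min ε δ, lt_min hε hδ, γ, hγ0, ?_, fun t ht => ?_⟩
  · have := hγ 0 h0
    rwa [hγ0, hXp] at this
  · have ht' : t ∈ Ioo (-ε) ε :=
      ⟨by linarith [ht.1, min_le_left ε δ], by linarith [ht.2, min_le_left ε δ]⟩
    refine ⟨hfix t ht', _, hγ t ht', hker _ (hfix t ht') (hδu ?_)⟩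
    rw [Real.dist_eq, sub_zero, abs_lt]
    exact ⟨by linarith [ht.1, min_le_right ε δ], by linarith [ht.2, min_le_right ε δ]⟩

/-! ### Rank, minors and lines of matrices -/

theorem Matrix.exists_rows_linearIndependent {m n K : Type*} [Fintype m] [Fintype n] [Field K]
    (A : Matrix m n K) : ∃ r : Fin A.rank → m, LinearIndependent K (A.submatrix r id).row := by
  obtain ⟨κ, a, ha, hspan, hli⟩ := exists_linearIndependent' K A.row
  have : Finite κ := Finite.of_injective a ha
  have := Fintype.ofFinite κ
  have hcard : Fintype.card κ = A.rank := by
    rw [A.rank_eq_finrank_span_row, ← hspan, finrank_span_eq_card hli]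
  let e : Fin A.rank ≃ κ := (finCongr hcard.symm).trans (Fintype.equivFin κ).symm
  exact ⟨a ∘ e, hli.comp e e.injective⟩

theorem Matrix.exists_submatrix_det_ne_zero {m n K : Type*} [Fintype m] [Fintype n] [Field K]
    (A : Matrix m n K) :
    ∃ (r : Fin A.rank → m) (c : Fin A.rank → n), (A.submatrix r c).det ≠ 0 := by
  obtain ⟨r, hr⟩ := A.exists_rows_linearIndependent
  obtain ⟨c, hc⟩ := (A.submatrix r id).transpose.exists_rows_linearIndependent
  have hrank : (A.submatrix r id).transpose.rank = A.rank := by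
    rw [Matrix.rank_transpose, hr.rank_matrix, Fintype.card_fin]
  let e : Fin A.rank ≃ Fin (A.submatrix r id).transpose.rank := finCongr hrank.symm
  refine ⟨r, c ∘ e, ?_⟩
  have h1 := hc.comp e e.injective
  have h2 : LinearIndependent K ((A.submatrix r (c ∘ e)).transpose).row := h1
  rw [Matrix.linearIndependent_rows_iff_isUnit, Matrix.isUnit_transpose,
    Matrix.isUnit_iff_isUnit_det] at h2
  exact h2.ne_zero

theorem Matrix.le_rank_of_submatrix_det_ne_zero {m n K : Type*} [Fintype n] [Field K]
    [Finite m] {k : ℕ} (A : Matrix m n K) (r : Fin k → m) (c : Fin k → n)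
    (h : (A.submatrix r c).det ≠ 0) : k ≤ A.rank := by
  have h1 := Matrix.rank_of_det_ne_zero h
  have h2 := A.rank_submatrix_le r c
  rw [h1, Fintype.card_fin] at h2
  exact h2

/-- A maximal nonzero minor at `s₁` is a nonzero polynomial in `s`, and the rank can drop below its
size only at the roots. -/
theorem Matrix.finite_setOf_rank_lt {m n K : Type*} [Fintype m] [Fintype n] [Field K]
    (A₀ A₁ : Matrix m n K) (s₁ : K) :
    {s : K | (A₀ + s • A₁).rank < (A₀ + s₁ • A₁).rank}.Finite := by
  obtain ⟨r, c, hdet⟩ := (A₀ + s₁ • A₁).exists_submatrix_det_ne_zero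
  let Q : Matrix (Fin (A₀ + s₁ • A₁).rank) (Fin (A₀ + s₁ • A₁).rank) (Polynomial K) :=
    Matrix.of fun i j => Polynomial.C (A₀ (r i) (c j)) + Polynomial.X * Polynomial.C (A₁ (r i) (c j))
  have hQ : ∀ s, Q.det.eval s = ((A₀ + s • A₁).submatrix r c).det := by
    intro s
    rw [← Polynomial.coe_evalRingHom, RingHom.map_det]
    congr 1
    ext i j
    simp [Q]
    exact mul_comm _ _
  have hne : Q.det ≠ 0 := by
    intro h0
    apply hdet
    rw [← hQ, h0, Polynomial.eval_zero]
  refine (Polynomial.finite_setOfPred_isRoot hne).subset fun s hs => ?_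
  by_contra hroot
  have : ((A₀ + s • A₁).submatrix r c).det ≠ 0 := by
    rw [← hQ]; exact hroot
  exact absurd (Matrix.le_rank_of_submatrix_det_ne_zero _ r c this) (not_le.2 hs)

open Module in
theorem LinearMap.finite_setOf_finrank_range_lt {K U L : Type*} [Field K] [AddCommGroup U]
    [Module K U] [FiniteDimensional K U] [AddCommGroup L] [Module K L] [FiniteDimensional K L]
    (f₀ f₁ : U →ₗ[K] L) (s₁ : K) :
    {s : K | finrank K (LinearMap.range (f₀ + s • f₁)) <
      finrank K (LinearMap.range (f₀ + s₁ • f₁))}.Finite := by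
  let b := Module.finBasis K U
  let b' := Module.finBasis K L
  have h : ∀ s : K, finrank K (LinearMap.range (f₀ + s • f₁)) =
      (LinearMap.toMatrix b b' f₀ + s • LinearMap.toMatrix b b' f₁).rank := by
    intro s
    rw [← map_smul, ← map_add, Matrix.rank_eq_finrank_range_toLin _ b' b, Matrix.toLin_toMatrix]
  simp only [h]
  exact Matrix.finite_setOf_rank_lt _ _ _

/-! ### Orbits of involutions and Gram-rigid vectors -/

/-- In an auxiliary linear order the representative is the smaller of `i` and `σ i`. The sets `i ≤ σ
i` and `σ i ≤ i` are equinumerous, cover everything and meet in the fixed points. This serves for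
vertices and for edges. -/
theorem Function.Involutive.exists_orbit_representative {α : Type*} [Fintype α] [DecidableEq α]
    {σ : α → α} (hσ : Function.Involutive σ) :
    ∃ r : α → α, (∀ i, r (σ i) = r i) ∧ (∀ i, r i = i ∨ r i = σ i) ∧
      2 * Fintype.card {i // r i = i} = Fintype.card α + Fintype.card {i // σ i = i} := by
  let _ : LinearOrder α := LinearOrder.lift' (Fintype.equivFin α) (Fintype.equivFin α).injective
  refine ⟨fun i => min i (σ i), fun i => by simp only [hσ i]; exact min_comm _ _,
    fun i => min_choice _ _, ?_⟩
  rw [Fintype.card_subtype, Fintype.card_subtype]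
  let S : Finset α := {i | i ≤ σ i}
  let S' : Finset α := {i | σ i ≤ i}
  have h1 : S.card = S'.card := by
    refine Finset.card_bij (fun i _ => σ i) ?_ ?_ ?_
    · intro i hi; simpa [S, S', hσ i] using hi
    · intro i _ j _ h; exact hσ.injective h
    · intro i hi; exact ⟨σ i, by simpa [S, S', hσ i] using hi, hσ i⟩
  have h2 := Finset.card_union_add_card_inter S S'
  have h3 : S ∪ S' = Finset.univ := by
    ext i; simpa [S, S'] using le_total i (σ i)
  have h4 : S ∩ S' = ({i | σ i = i} : Finset α) := by
    ext i; simpa [S, S'] using ⟨fun h => le_antisymm h.2 h.1, fun h => ⟨h.ge, h.le⟩⟩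
  have h5 : ({i | min i (σ i) = i} : Finset α) = S := by
    ext i; simp [S]
  rw [h5]
  rw [h3, h4, Finset.card_univ] at h2
  omega

theorem card_sigma_fin_mul_two (D : ℕ) :
    Fintype.card ((k : Fin D) × Fin k) * 2 = D * (D - 1) := by
  rw [Fintype.card_sigma]
  simp only [Fintype.card_fin]
  rw [Fin.sum_univ_eq_sum_range (fun k => k) D, Finset.sum_range_id_mul_two]

open scoped InnerProductSpace in
/-- For any finite index set there is a configuration of vectors whose Gram matrix determines it
infinitesimally up to a space of dimension at most that of the rotations. -/
theorem OrthonormalBasis.exists_gram_rigid {D : ℕ} {F : Type*} [NormedAddCommGroup F]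
    [InnerProductSpace ℝ F] (b : OrthonormalBasis (Fin D) ℝ F) (ι : Type*) [Fintype ι] :
    ∃ (v : ι → F) (T : (ι → F) →ₗ[ℝ] ((k : Fin D) × Fin k → ℝ)),
      ∀ u : ι → F, (∀ i j, ⟪v i, u j⟫_ℝ + ⟪v j, u i⟫_ℝ = 0) → T u = 0 → u = 0 := by
  classical
  have hzero : ∀ x : F, (∀ k, ⟪b k, x⟫_ℝ = 0) → x = 0 := by
    intro x hx
    rw [← b.sum_repr' x]
    simp [hx]
  rcases le_total (Fintype.card ι) D with hle | hle
  · let φ : ι → Fin D := fun s => Fin.castLE hle (Fintype.equivFin ι s)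
    have hφ : Function.Injective φ :=
      (Fin.castLE_injective hle).comp (Fintype.equivFin ι).injective
    -- The matrix of products `⟪b (φ i), u j⟫` is skew, so the entries on one side of the diagonal
    -- suffice. `T` reads these, along with the components in directions outside the range of `φ`; a
    -- coordinate with no matching `s` is 0.
    let T : (ι → F) →ₗ[ℝ] ((k : Fin D) × Fin k → ℝ) := LinearMap.pi fun x =>
      ∑ s, if (φ s : ℕ) = x.2 then (innerₛₗ ℝ (b x.1)).comp (LinearMap.proj s) else 0
    refine ⟨fun s => b (φ s), T, fun u hu hT => ?_⟩
    replace hu : ∀ i j, ⟪b (φ i), u j⟫_ℝ + ⟪b (φ j), u i⟫_ℝ = 0 := hu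
    have hT' : ∀ s k, φ s < k → ⟪b k, u s⟫_ℝ = 0 := by
      intro s k hk
      have h1 := congrFun hT ⟨k, ⟨φ s, hk⟩⟩
      have h2 : T u ⟨k, ⟨φ s, hk⟩⟩ = ⟪b k, u s⟫_ℝ := by
        simp only [T, LinearMap.pi_apply, LinearMap.sum_apply]
        rw [Finset.sum_eq_single s]
        · simp
        · intro s' _ hs'
          have : (φ s' : ℕ) ≠ φ s := fun h => hs' (hφ (Fin.ext h))
          simp [this]
        · simp
      rw [← h2, h1]; rfl
    funext s
    refine hzero _ fun k => ?_
    rcases lt_trichotomy (φ s) k with h | h | h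
    · exact hT' s k h
    · have := hu s s
      rw [h] at this
      linarith
    · have hk : (k : ℕ) < Fintype.card ι := lt_trans h (Fintype.equivFin ι s).2
      let s' := (Fintype.equivFin ι).symm ⟨k, hk⟩
      have hs' : φ s' = k := by simp [φ, s']
      have h1 := hu s s'
      rw [hT' s' (φ s) (hs' ▸ h), hs'] at h1
      linarith
  · let e : Fin D → ι := fun k => (Fintype.equivFin ι).symm (Fin.castLE hle k)
    have he : Function.Injective e :=
      (Fintype.equivFin ι).symm.injective.comp (Fin.castLE_injective hle)
    let T : (ι → F) →ₗ[ℝ] ((k : Fin D) × Fin k → ℝ) := LinearMap.pi fun x =>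
      (innerₛₗ ℝ (b x.1)).comp (LinearMap.proj (e ⟨x.2, x.2.2.trans x.1.2⟩))
    -- Vectors beyond the first `D` may be 0: once `u` vanishes on the basis indices, pairing `s`
    -- with each `e k` forces `u s = 0`.
    refine ⟨Function.extend e b 0, T, fun u hu hT => ?_⟩
    have hT' : ∀ i k, i < k → ⟪b k, u (e i)⟫_ℝ = 0 := by
      intro i k hk
      exact congrFun hT ⟨k, ⟨i, hk⟩⟩
    have he0 : ∀ i, u (e i) = 0 := by
      intro i
      refine hzero _ fun k => ?_
      have h1 := hu (e i) (e k)
      rw [he.extend_apply, he.extend_apply] at h1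
      rcases lt_trichotomy i k with h | h | h
      · exact hT' i k h
      · subst h; linarith
      · rw [hT' k i h] at h1; linarith
    funext s
    refine hzero _ fun k => ?_
    have h1 := hu s (e k)
    rw [he0, inner_zero_right, he.extend_apply] at h1
    linarith

/-! ### Maximal rank on the fixed space of a projection -/

open Module in
-- If `f (P u) = f (v - P v)`, the difference of the arguments lies in the kernel, and so does its
-- image `P u` under `P`. Hence the two partial ranges meet trivially.
theorem LinearMap.finrank_range_eq_add_of_ker_invariant {K U L : Type*} [Field K] [AddCommGroup U]
    [Module K U] [FiniteDimensional K U] [AddCommGroup L] [Module K L]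
    (f : U →ₗ[K] L) (P : U →ₗ[K] U) (hP : ∀ u, P (P u) = P u) (hf : ∀ u, f u = 0 → f (P u) = 0) :
    finrank K (LinearMap.range f) = finrank K (LinearMap.range (f ∘ₗ P)) +
      finrank K (LinearMap.range (f ∘ₗ (LinearMap.id - P))) := by
  have hsup : LinearMap.range f =
      LinearMap.range (f ∘ₗ P) ⊔ LinearMap.range (f ∘ₗ (LinearMap.id - P)) := by
    apply le_antisymm
    · rintro _ ⟨u, rfl⟩
      have : f u = (f ∘ₗ P) u + (f ∘ₗ (LinearMap.id - P)) u := by simp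
      rw [this]
      exact Submodule.add_mem_sup (LinearMap.mem_range_self _ u) (LinearMap.mem_range_self _ u)
    · exact sup_le (LinearMap.range_comp_le_range _ _) (LinearMap.range_comp_le_range _ _)
  have hinf : LinearMap.range (f ∘ₗ P) ⊓ LinearMap.range (f ∘ₗ (LinearMap.id - P)) = ⊥ := by
    rw [eq_bot_iff]
    rintro _ ⟨⟨u, rfl⟩, ⟨v, hv⟩⟩
    have h1 : f (P u - (v - P v)) = 0 := by
      rw [map_sub, sub_eq_zero]; exact hv.symm
    have h2 := hf _ h1
    simp only [map_sub, hP, sub_self, sub_zero] at h2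
    simpa using h2
  have h := Submodule.finrank_sup_add_finrank_inf_eq (LinearMap.range (f ∘ₗ P))
    (LinearMap.range (f ∘ₗ (LinearMap.id - P)))
  rw [hinf, finrank_bot, add_zero] at h
  rw [hsup, h]

open Module in
/-- If `p` maximizes the rank of `B p` over the fixed space of a compatible projection `P`, then
it also maximizes the rank of the restriction of `B p` to this fixed space. -/
theorem finrank_range_comp_le_of_maximal {U L : Type*} [AddCommGroup U]
    [Module ℝ U] [FiniteDimensional ℝ U] [AddCommGroup L] [Module ℝ L] [FiniteDimensional ℝ L]
    (B : U →ₗ[ℝ] U →ₗ[ℝ] L) (P : U →ₗ[ℝ] U) (hP : ∀ u, P (P u) = P u)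
    (hBP : ∀ q u, P q = q → B q u = 0 → B q (P u) = 0) {p : U} (hp : P p = p)
    (hmax : ∀ q, P q = q →
      finrank ℝ (LinearMap.range (B q)) ≤ finrank ℝ (LinearMap.range (B p)))
    {q : U} (hq : P q = q) :
    finrank ℝ (LinearMap.range (B q ∘ₗ P)) ≤ finrank ℝ (LinearMap.range (B p ∘ₗ P)) := by
  -- For all but finitely many `s`, at `p + s • (q - p)` the rank on the image of `P` is at least
  -- that at `q` (`s = 1`), and on the complement at least that at `p` (`s = 0`). The sum cannot
  -- exceed the total at `p`, which gives the claim.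
  have hfin := (LinearMap.finite_setOf_finrank_range_lt (B p ∘ₗ P) (B (q - p) ∘ₗ P) 1).union
    (LinearMap.finite_setOf_finrank_range_lt (B p ∘ₗ (LinearMap.id - P))
      (B (q - p) ∘ₗ (LinearMap.id - P)) 0)
  obtain ⟨s, hs⟩ := hfin.exists_notMem
  have hB : ∀ (s : ℝ) (Q : U →ₗ[ℝ] U),
      B p ∘ₗ Q + s • (B (q - p) ∘ₗ Q) = B (p + s • (q - p)) ∘ₗ Q := by
    intro s Q
    rw [map_add, map_smul, LinearMap.add_comp, LinearMap.smul_comp]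
  simp only [Set.mem_union, Set.mem_ofPred_eq, not_or, not_lt] at hs
  obtain ⟨hs₁, hs₂⟩ := hs
  rw [hB, hB, one_smul, add_sub_cancel] at hs₁
  rw [hB, hB, zero_smul, add_zero] at hs₂
  have hps : P (p + s • (q - p)) = p + s • (q - p) := by simp [hp, hq]
  have h1 := LinearMap.finrank_range_eq_add_of_ker_invariant _ P hP (hBP _ · hps)
  have h2 := LinearMap.finrank_range_eq_add_of_ker_invariant _ P hP (hBP p · hp)
  have h3 := hmax _ hps
  omega

/-! ### The rigidity map and symmetric averaging -/

namespace SymFramework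

open Module
open scoped InnerProductSpace

section

variable {V : Type*} {d : ℕ}

theorem rigidityMatrix_apply_mk [DecidableEq V] (G : SimpleGraph V) (p : V → Space d) {i j : V}
    (hij : s(i, j) ∈ G.edgeSet) (vk : V × Fin d) :
    rigidityMatrix G p ⟨s(i, j), hij⟩ vk =
      ((if vk.1 = i then 1 else 0) - (if vk.1 = j then 1 else 0)) * (p i vk.2 - p j vk.2) :=
  rfl

/-- The coordinates of a configuration, as a vector indexed by the columns of the rigidity
matrix. -/
def coords : (V → Space d) →ₗ[ℝ] (V × Fin d → ℝ) where
  toFun w vk := w vk.1 vk.2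
  map_add' _ _ := rfl
  map_smul' _ _ := rfl

theorem coords_apply (w : V → Space d) (vk : V × Fin d) : coords w vk = w vk.1 vk.2 :=
  rfl

theorem coords_surjective : Function.Surjective (coords : (V → Space d) →ₗ[ℝ] _) :=
  fun x => ⟨fun v => WithLp.toLp 2 fun k => x (v, k), rfl⟩

theorem rigidityMatrix_mulVec_mk [Fintype V] [DecidableEq V] (G : SimpleGraph V)
    (p w : V → Space d) {i j : V} (hij : s(i, j) ∈ G.edgeSet) :
    (rigidityMatrix G p).mulVec (coords w) ⟨s(i, j), hij⟩ = ⟪p i - p j, w i - w j⟫_ℝ := by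
  simp only [Matrix.mulVec, dotProduct, rigidityMatrix_apply_mk, Fintype.sum_prod_type]
  rw [Finset.sum_comm, PiLp.inner_apply]
  refine Finset.sum_congr rfl fun k _ => ?_
  simp only [coords_apply, sub_mul, ite_mul, one_mul, zero_mul,
    Finset.sum_sub_distrib, Finset.sum_ite_eq', Finset.mem_univ, if_true, PiLp.sub_apply,
    RCLike.inner_apply, conj_trivial]
  ring

/-- The rigidity matrix as a bilinear map: it is linear in the configuration, and applied to a
velocity assignment it yields the rate of strain of every edge. -/
noncomputable def rigidityMap [Fintype V] [DecidableEq V] (d : ℕ) (G : SimpleGraph V) :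
    (V → Space d) →ₗ[ℝ] (V → Space d) →ₗ[ℝ] (G.edgeSet → ℝ) :=
  LinearMap.mk₂ ℝ (fun p w => (rigidityMatrix G p).mulVec (coords w))
    (fun p q w => by
      ext ⟨e, he⟩
      induction e with | _ i j
      simp only [Pi.add_apply, rigidityMatrix_mulVec_mk, ← inner_add_left]
      congr 1; abel)
    (fun c p w => by
      ext ⟨e, he⟩
      induction e with | _ i j
      simp only [Pi.smul_apply, rigidityMatrix_mulVec_mk, ← smul_sub, inner_smul_left,
        conj_trivial, smul_eq_mul])
    (fun p w w' => by rw [map_add, Matrix.mulVec_add])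
    (fun c p w => by rw [map_smul, Matrix.mulVec_smul])

theorem rigidityMap_apply [Fintype V] [DecidableEq V] (G : SimpleGraph V) (p w : V → Space d) :
    rigidityMap d G p w = (rigidityMatrix G p).mulVec (coords w) :=
  rfl

theorem rigidityMap_mk [Fintype V] [DecidableEq V] (G : SimpleGraph V)
    (p w : V → Space d) {i j : V} (hij : s(i, j) ∈ G.edgeSet) :
    rigidityMap d G p w ⟨s(i, j), hij⟩ = ⟪p i - p j, w i - w j⟫_ℝ :=
  rigidityMatrix_mulVec_mk G p w hij

theorem rigidityMap_comm [Fintype V] [DecidableEq V] (G : SimpleGraph V) (p w : V → Space d) :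
    rigidityMap d G p w = rigidityMap d G w p := by
  ext ⟨e, he⟩
  induction e with | _ i j
  rw [rigidityMap_mk, rigidityMap_mk, real_inner_comm]

theorem rigidityMap_eq_zero_iff [Fintype V] [DecidableEq V] (G : SimpleGraph V)
    (p w : V → Space d) :
    rigidityMap d G p w = 0 ↔ ∀ i j, G.Adj i j → ⟪p i - p j, w i - w j⟫_ℝ = 0 := by
  constructor
  · intro h i j hij
    rw [← rigidityMap_mk G p w hij, h]
    rfl
  · intro h
    ext ⟨e, he⟩
    induction e with | _ i j
    rw [rigidityMap_mk]
    exact h i j he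

theorem finrank_range_rigidityMap [Fintype V] [DecidableEq V] (G : SimpleGraph V)
    (p : V → Space d) :
    finrank ℝ (LinearMap.range (rigidityMap d G p)) = (rigidityMatrix G p).rank := by
  have : rigidityMap d G p = (rigidityMatrix G p).mulVecLin ∘ₗ coords := rfl
  rw [this, LinearMap.range_comp_of_range_eq_top _ (LinearMap.range_eq_top.2 coords_surjective)]
  rfl

/-- The averaging projection onto the configurations that are symmetric with respect to the
isometry `h` and the permutation `σ`. -/
noncomputable def average (h : Orth d) (σ : V → V) : (V → Space d) →ₗ[ℝ] (V → Space d) where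
  toFun w i := (1 / 2 : ℝ) • (w i + h (w (σ i)))
  map_add' w w' := by
    ext1 i
    simp only [Pi.add_apply, map_add, ← smul_add]
    congr 1; abel
  map_smul' c w := by
    ext1 i
    simp only [Pi.smul_apply, map_smul, RingHom.id_apply, ← smul_add, smul_comm c]

theorem average_apply (h : Orth d) (σ : V → V) (w : V → Space d) (i : V) :
    average h σ w i = (1 / 2 : ℝ) • (w i + h (w (σ i))) :=
  rfl

theorem average_eq_self_iff {h : Orth d} {σ : V → V} (hh : ∀ x, h (h x) = x) (w : V → Space d) :
    average h σ w = w ↔ ∀ i, h (w i) = w (σ i) := by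
  constructor
  · intro hw i
    have h1 : (1 / 2 : ℝ) • (w i + h (w (σ i))) = w i := congrFun hw i
    have h2 : h (w (σ i)) = w i := by
      have : w i + h (w (σ i)) = (2 : ℝ) • w i := by
        rw [← h1, smul_smul]; norm_num [h1]
      rw [two_smul] at this
      exact add_left_cancel this
    rw [← h2, hh]
  · intro hw
    ext1 i
    rw [average_apply, ← hw i, hh, ← two_smul ℝ, smul_smul]
    norm_num

theorem average_average {h : Orth d} {σ : V → V} (hh : ∀ x, h (h x) = x)
    (hσ : Function.Involutive σ) (w : V → Space d) :
    average h σ (average h σ w) = average h σ w := by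
  rw [average_eq_self_iff hh]
  intro i
  simp only [average_apply, map_smul, map_add, hh, hσ i]
  rw [add_comm]

/-- Transported by the isometry `h`, the condition on the edge `{σ i, σ j}` becomes the condition on
`{i, j}` for the velocity `h ∘ w ∘ σ`. -/
theorem rigidityMap_average_eq_zero [Fintype V] [DecidableEq V] {G : SimpleGraph V} {h : Orth d}
    {σ : V → V} (hh : ∀ x, h (h x) = x) (hG : ∀ i j, G.Adj i j → G.Adj (σ i) (σ j))
    {p w : V → Space d} (hp : average h σ p = p) (hw : rigidityMap d G p w = 0) :
    rigidityMap d G p (average h σ w) = 0 := by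
  rw [average_eq_self_iff hh] at hp
  rw [rigidityMap_eq_zero_iff] at hw ⊢
  intro i j hij
  have h1 := hw i j hij
  have h2 := hw _ _ (hG i j hij)
  rw [← hp, ← hp, ← map_sub, ← h.inner_map_map, hh] at h2
  rw [average_apply, average_apply, ← smul_sub, inner_smul_right, add_sub_add_comm, inner_add_right,
    h1, ← map_sub, zero_add, ← mul_zero (1 / 2 : ℝ), ← h2]

end

end SymFramework

/-! ### Symmetric motions of the complete graph -/

namespace SymFramework

open Module
open scoped InnerProductSpace

section

variable {V : Type*} {d : ℕ}

/-- Antisymmetric extension of a family of vectors given on representatives `i` of the orbits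
`{i, σ i}` of size two. -/
noncomputable def antisymm {r σ : V → V} [DecidableEq V] {F : Submodule ℝ (Space d)} :
    ({i // r i = i ∧ σ i ≠ i} → F) →ₗ[ℝ] (V → Space d) where
  toFun b i := (if hi : r i = i ∧ σ i ≠ i then (b ⟨i, hi⟩ : Space d) else 0) -
    (if hi : r (σ i) = σ i ∧ σ (σ i) ≠ σ i then (b ⟨σ i, hi⟩ : Space d) else 0)
  map_add' b b' := by
    ext1 i
    simp only [Pi.add_apply, Submodule.coe_add]
    split_ifs <;> module
  map_smul' c b := by
    ext1 i
    simp only [Pi.smul_apply, Submodule.coe_smul, RingHom.id_apply, smul_sub]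
    split_ifs <;> module

section

variable [DecidableEq V] {r σ : V → V} {F : Submodule ℝ (Space d)}

theorem antisymm_apply_map (hσ : Function.Involutive σ) (b : {i // r i = i ∧ σ i ≠ i} → F)
    (i : V) : antisymm b (σ i) = -antisymm b i := by
  simp only [antisymm, LinearMap.coe_mk, AddHom.coe_mk, neg_sub]
  congr 1
  have : ∀ j, j = i → (if hi : r j = j ∧ σ j ≠ j then (b ⟨j, hi⟩ : Space d) else 0) =
      if hi : r i = i ∧ σ i ≠ i then (b ⟨i, hi⟩ : Space d) else 0 := by
    rintro j rfl; rfl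
  exact this _ (hσ i)

theorem antisymm_apply_coe (hr : ∀ i, r (σ i) = r i) (b : {i // r i = i ∧ σ i ≠ i} → F)
    (i : {i // r i = i ∧ σ i ≠ i}) : antisymm b i = (b i : Space d) := by
  simp only [antisymm, LinearMap.coe_mk, AddHom.coe_mk]
  rw [dif_pos i.2, dif_neg, sub_zero]
  rw [hr, i.2.1]
  exact fun h => i.2.2 h.1.symm

theorem antisymm_mem (b : {i // r i = i ∧ σ i ≠ i} → F) (i : V) : antisymm b i ∈ F := by
  simp only [antisymm, LinearMap.coe_mk, AddHom.coe_mk]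
  refine F.sub_mem ?_ ?_ <;> split_ifs <;> simp

/-- The symmetric configuration given by the components of the points in the axis `F`, one for each
orbit, and by their components orthogonal to `F`, one for each orbit of size two. -/
noncomputable def orbitConfig (r σ : V → V) (F : Submodule ℝ (Space d)) (hrr : ∀ i, r (r i) = r i) :
    (({i // r i = i} → F) × ({i // r i = i ∧ σ i ≠ i} → Fᗮ)) →ₗ[ℝ] (V → Space d) where
  toFun x i := (x.1 ⟨r i, hrr i⟩ : Space d) + antisymm x.2 i
  map_add' x y := by
    ext1 i
    simp only [Prod.fst_add, Prod.snd_add, Pi.add_apply, Submodule.coe_add, map_add]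
    abel
  map_smul' c x := by
    ext1 i
    simp only [Prod.smul_fst, Prod.smul_snd, Pi.smul_apply, Submodule.coe_smul, map_smul,
      smul_add, RingHom.id_apply]

theorem orbitConfig_apply {hrr : ∀ i, r (r i) = r i}
    (x : ({i // r i = i} → F) × ({i // r i = i ∧ σ i ≠ i} → Fᗮ)) (i : V) :
    orbitConfig r σ F hrr x i = (x.1 ⟨r i, hrr i⟩ : Space d) + antisymm x.2 i :=
  rfl

theorem orbitConfig_symm {h : Orth d} (hσ : Function.Involutive σ) (hr : ∀ i, r (σ i) = r i)
    (hF : ∀ x ∈ F, h x = x) (hF' : ∀ x ∈ Fᗮ, h x = -x) {hrr : ∀ i, r (r i) = r i}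
    (x : ({i // r i = i} → F) × ({i // r i = i ∧ σ i ≠ i} → Fᗮ)) (i : V) :
    h (orbitConfig r σ F hrr x i) = orbitConfig r σ F hrr x (σ i) := by
  rw [orbitConfig_apply, orbitConfig_apply, map_add, hF _ (Subtype.mem _),
    hF' _ (antisymm_mem _ _), antisymm_apply_map hσ]
  simp only [hr]

theorem inner_add_add_of_mem_orthogonal {a a' b b' : Space d} (ha : a ∈ F) (ha' : a' ∈ F)
    (hb : b ∈ Fᗮ) (hb' : b' ∈ Fᗮ) : ⟪a + b, a' + b'⟫_ℝ = ⟪a, a'⟫_ℝ + ⟪b, b'⟫_ℝ := by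
  rw [inner_add_left, inner_add_right, inner_add_right, Submodule.inner_right_of_mem_orthogonal ha hb',
    Submodule.inner_left_of_mem_orthogonal ha' hb]
  ring

/-- The infinitesimal rigidity conditions of the complete graph for a configuration with half-turn
symmetry decouple into conditions on the axis and on its orthogonal complement. -/
theorem inner_orbitConfig_decouple [Fintype V] (hσ : Function.Involutive σ)
    (hr : ∀ i, r (σ i) = r i) {hrr : ∀ i, r (r i) = r i}
    {x y : ({i // r i = i} → F) × ({i // r i = i ∧ σ i ≠ i} → Fᗮ)}
    (hxy : rigidityMap d ⊤ (orbitConfig r σ F hrr x) (orbitConfig r σ F hrr y) = 0) :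
    (∀ i j, ⟪x.1 i - x.1 j, y.1 i - y.1 j⟫_ℝ = 0) ∧
      ∀ i j, ⟪x.2 i, y.2 j⟫_ℝ + ⟪x.2 j, y.2 i⟫_ℝ = 0 := by
  rw [rigidityMap_eq_zero_iff] at hxy
  have h1 : ∀ i j, ⟪(x.1 ⟨r i, hrr i⟩ - x.1 ⟨r j, hrr j⟩ : Space d),
      (y.1 ⟨r i, hrr i⟩ - y.1 ⟨r j, hrr j⟩ : Space d)⟫_ℝ +
      ⟪(antisymm x.2 i - antisymm x.2 j : Space d), antisymm y.2 i - antisymm y.2 j⟫_ℝ = 0 := by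
    intro i j
    rw [← inner_add_add_of_mem_orthogonal (F := F) (F.sub_mem (Subtype.mem _) (Subtype.mem _))
      (F.sub_mem (Subtype.mem _) (Subtype.mem _))
      (Fᗮ.sub_mem (antisymm_mem _ _) (antisymm_mem _ _))
      (Fᗮ.sub_mem (antisymm_mem _ _) (antisymm_mem _ _)), ← add_sub_add_comm, ← add_sub_add_comm]
    by_cases hij : i = j
    · subst hij; simp
    · exact hxy i j hij
  have h2 : ∀ i j, ⟪(antisymm x.2 i : Space d), antisymm y.2 j⟫_ℝ +
      ⟪(antisymm x.2 j : Space d), antisymm y.2 i⟫_ℝ = 0 := by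
    intro i j
    -- Replacing `j` by `σ j` keeps the components in `F` and negates the orthogonal ones, so the
    -- difference of the two equations isolates the cross terms.
    have e1 := h1 i j
    have e2 := h1 i (σ j)
    simp only [hr, antisymm_apply_map hσ, sub_neg_eq_add] at e2
    simp only [inner_add_left, inner_add_right, inner_sub_left, inner_sub_right] at e1 e2
    linarith
  constructor
  · intro i j
    have e1 := h1 i j
    have e2 := h2 i j
    have e3 := h2 i i
    have e4 := h2 j j
    have hi : (⟨r i, hrr i⟩ : {i // r i = i}) = i := Subtype.ext i.2
    have hj : (⟨r j, hrr j⟩ : {i // r i = i}) = j := Subtype.ext j.2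
    rw [hi, hj] at e1
    rw [Submodule.coe_inner, Submodule.coe_sub, Submodule.coe_sub]
    simp only [inner_sub_left, inner_sub_right] at e1 ⊢
    linarith
  · intro i j
    have := h2 i j
    simpa only [antisymm_apply_coe hr, Submodule.coe_inner] using this

/-- There is a symmetric configuration at which the complete graph has only as many infinitesimal
motions preserving the symmetry as the group of motions commuting with the half-turn allows. -/
theorem exists_symmetric_rank_ge [Fintype V] {h : Orth d} (hh : ∀ x, h (h x) = x)
    (hσ : Function.Involutive σ)
    {D : ℕ} (hD : finrank ℝ F = D) (hD' : finrank ℝ Fᗮ = 2) (hF : ∀ x ∈ F, h x = x)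
    (hF' : ∀ x ∈ Fᗮ, h x = -x) (hr : ∀ i, r (σ i) = r i) (hrr : ∀ i, r (r i) = r i)
    (o : {i // r i = i}) :
    ∃ q : V → Space d, average h σ q = q ∧
      Fintype.card {i // r i = i} * D + Fintype.card {i // r i = i ∧ σ i ≠ i} * 2 ≤
        finrank ℝ (LinearMap.range (rigidityMap d ⊤ q ∘ₗ average h σ)) +
          (D + (Fintype.card ((k : Fin D) × Fin k) + Fintype.card ((k : Fin 2) × Fin k))) := by
  let bF : OrthonormalBasis (Fin D) ℝ F := (stdOrthonormalBasis ℝ F).reindex (finCongr hD)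
  let bF' : OrthonormalBasis (Fin 2) ℝ Fᗮ := (stdOrthonormalBasis ℝ Fᗮ).reindex (finCongr hD')
  obtain ⟨c, T, hcT⟩ := bF.exists_gram_rigid {i : {i // r i = i} // i ≠ o}
  obtain ⟨v, T', hvT⟩ := bF'.exists_gram_rigid {i // r i = i ∧ σ i ≠ i}
  -- The orbit `o` sits at the origin of `F`, so the other points of `F` are the vectors whose Gram
  -- conditions are controlled.
  let x : ({i // r i = i} → F) × ({i // r i = i ∧ σ i ≠ i} → Fᗮ) :=
    (fun i => if hi : i ≠ o then c ⟨i, hi⟩ else 0, v)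
  have hsymm : ∀ y, average h σ (orbitConfig r σ F hrr y) = orbitConfig r σ F hrr y := fun y =>
    (average_eq_self_iff hh _).2 (orbitConfig_symm hσ hr hF hF' y)
  let q := orbitConfig r σ F hrr x
  refine ⟨q, hsymm x, ?_⟩
  let f := rigidityMap d ⊤ q ∘ₗ average h σ
  let fst' := LinearMap.fst ℝ ({i // r i = i} → F) ({i // r i = i ∧ σ i ≠ i} → Fᗮ)
  let rel : ({i // r i = i} → F) →ₗ[ℝ] ({i : {i // r i = i} // i ≠ o} → F) :=
    LinearMap.pi fun i =>
      (LinearMap.proj i.1 : ({i // r i = i} → F) →ₗ[ℝ] F) - LinearMap.proj o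
  -- Besides the strain, `Ψ` records the data that fix a rigid motion: translation along `F` (the
  -- value at `o`), rotation in `F` (`T`) and rotation in `Fᗮ` (`T'`). Injectivity yields the
  -- dimension bound.
  let Ψ : (({i // r i = i} → F) × ({i // r i = i ∧ σ i ≠ i} → Fᗮ)) →ₗ[ℝ]
      (LinearMap.range f × (F × (((k : Fin D) × Fin k → ℝ) × ((k : Fin 2) × Fin k → ℝ)))) :=
    (f.rangeRestrict ∘ₗ orbitConfig r σ F hrr).prod
      ((LinearMap.proj o ∘ₗ fst').prod ((T ∘ₗ rel ∘ₗ fst').prod (T' ∘ₗ LinearMap.snd ℝ _ _)))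
  have hΨ : Function.Injective Ψ := by
    rw [← LinearMap.ker_eq_bot, LinearMap.ker_eq_bot']
    intro y hy
    have e0 : rigidityMap d ⊤ q (orbitConfig r σ F hrr y) = 0 := by
      have : f (orbitConfig r σ F hrr y) = 0 := congrArg (fun z => Subtype.val z.1) hy
      rw [← hsymm y]; exact this
    have eo : y.1 o = 0 := congrArg (fun z => z.2.1) hy
    have eT : T (rel y.1) = 0 := congrArg (fun z => z.2.2.1) hy
    have eT' : T' y.2 = 0 := congrArg (fun z => z.2.2.2) hy
    obtain ⟨h1, h2⟩ := inner_orbitConfig_decouple hσ hr e0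
    have hy2 : y.2 = 0 := hvT _ h2 eT'
    have hxo : x.1 o = 0 := by simp [x]
    have hxc : ∀ i : {i : {i // r i = i} // i ≠ o}, x.1 i = c i := fun i => dif_pos i.2
    have hrel : ∀ i, rel y.1 i = y.1 i - y.1 o := fun i => rfl
    have hy1 : rel y.1 = 0 := by
      refine hcT _ (fun i j => ?_) eT
      -- Polarization: the conditions on the pairs `i o`, `j o` and `i j` combine into the Gram
      -- condition on `i`, `j`.
      have e1 := h1 i o
      have e2 := h1 j o
      have e3 := h1 i j
      rw [hrel, hrel, eo, sub_zero, sub_zero, ← hxc, ← hxc]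
      rw [hxo, eo, sub_zero, sub_zero] at e1 e2
      simp only [inner_sub_left, inner_sub_right] at e3
      linarith
    refine Prod.ext ?_ hy2
    ext1 i
    by_cases hi : i = o
    · rw [hi, eo]; rfl
    · have := congrFun hy1 ⟨i, hi⟩
      rw [hrel, eo, sub_zero] at this
      exact this
  have hfin := LinearMap.finrank_le_finrank_of_injective hΨ
  simp only [finrank_prod, finrank_pi_fintype, finrank_self, hD, hD', Finset.sum_const,
    Finset.card_univ, smul_eq_mul, mul_one] at hfin
  exact hfin

end

end

end SymFramework

/-! ### Half-turns, mechanisms and the count -/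

namespace SymFramework

open Module
open scoped InnerProductSpace

section

variable {V : Type*} {d : ℕ}

theorem IsHalfTurn.apply_apply {h : Orth d} (hh : IsHalfTurn h) (x : Space d) : h (h x) = x := by
  obtain ⟨F, -, hF, hF'⟩ := hh
  obtain ⟨a, ha, b, hb, rfl⟩ := F.exists_add_mem_mem_orthogonal x
  rw [map_add, hF a ha, hF' b hb, map_add, hF a ha, map_neg, hF' b hb, neg_neg]

theorem halfTurn_mul_self {h : Orth d} (hh : IsHalfTurn h) : halfTurn h * halfTurn h = 1 := by
  apply Subtype.ext
  change h * h = 1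
  ext1 x
  exact hh.apply_apply x

theorem eq_one_or_eq_halfTurn {h : Orth d} (hh : IsHalfTurn h) (x : halfTurnGroup h) :
    x = 1 ∨ x = halfTurn h := by
  obtain ⟨k, hk⟩ := Subgroup.mem_zpowers_iff.1 x.2
  have hx : x = halfTurn h ^ k := by
    apply Subtype.ext
    rw [← hk]; rfl
  rcases Int.even_or_odd' k with ⟨m, rfl | rfl⟩
  · left
    rw [hx, zpow_mul, zpow_two, halfTurn_mul_self hh, one_zpow]
  · right
    rw [hx, zpow_add, zpow_mul, zpow_two, halfTurn_mul_self hh, one_zpow, one_mul, zpow_one]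

variable {G : SimpleGraph V} {h : Orth d}

theorem mem_symConfigs_iff (hh : IsHalfTurn h) (Φ : halfTurnGroup h →* (G ≃g G))
    (p : V → Space d) :
    p ∈ symConfigs Φ ↔ ∀ i, h (p i) = p (Φ (halfTurn h) i) := by
  refine ⟨fun hp => hp (halfTurn h), fun hp x i => ?_⟩
  rcases eq_one_or_eq_halfTurn hh x with rfl | rfl
  · rw [map_one]; rfl
  · exact hp i

theorem map_halfTurn_involutive (hh : IsHalfTurn h) (Φ : halfTurnGroup h →* (G ≃g G)) :
    Function.Involutive (Φ (halfTurn h)) := by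
  intro i
  change (Φ (halfTurn h) * Φ (halfTurn h)) i = i
  rw [← map_mul, halfTurn_mul_self hh, map_one]
  rfl

/-- Each minor for `H` is also a minor for the complete graph, so one that is nonzero at `q` is
nonzero at `p`. -/
theorem IsSymGeneric.rank_le [Fintype V] [DecidableEq V] {S : Subgroup (Orth d)}
    {Φ : S →* (G ≃g G)} {p : V → Space d} (hp : IsSymGeneric Φ p) (H : SimpleGraph V)
    {q : V → Space d} (hq : q ∈ symConfigs Φ) :
    (rigidityMatrix H q).rank ≤ (rigidityMatrix H p).rank := by
  classical
  obtain ⟨r, c, hdet⟩ := (rigidityMatrix H q).exists_submatrix_det_ne_zero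
  refine Matrix.le_rank_of_submatrix_det_ne_zero _ r c fun h0 => hdet ?_
  have hle : H.edgeSet ⊆ (⊤ : SimpleGraph V).edgeSet := SimpleGraph.edgeSet_mono le_top
  exact hp.2 _ (fun i => ⟨r i, hle (r i).2⟩) c h0 q hq

/-- At a symmetric `p`, a symmetric velocity strains the edges of an orbit equally, so
representatives determine the strain. -/
theorem finrank_range_rigidityMap_average_le [Fintype V] [DecidableEq V]
    (hh : ∀ x, h (h x) = x) (σ : G ≃g G) (hσ : Function.Involutive σ) {p : V → Space d}
    (hp : average h σ p = p) {r : G.edgeSet → G.edgeSet} (hrr : ∀ e, r (r e) = r e)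
    (hr : ∀ e, r e = e ∨ r e = σ.mapEdgeSet e) [Fintype {e // r e = e}] :
    finrank ℝ (LinearMap.range (rigidityMap d G p ∘ₗ average h σ)) ≤
      Fintype.card {e // r e = e} := by
  classical
  have hsymm : ∀ w e, rigidityMap d G p (average h σ w) (σ.mapEdgeSet e) =
      rigidityMap d G p (average h σ w) e := by
    rintro w ⟨e, he⟩
    induction e with | _ i j
    have hw := (average_eq_self_iff hh _).1 (average_average hh hσ w)
    have hp' := (average_eq_self_iff hh _).1 hp
    have hadj : s(σ i, σ j) ∈ G.edgeSet := (σ.mapEdgeSet ⟨s(i, j), he⟩).2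
    have h1 : σ.mapEdgeSet ⟨s(i, j), he⟩ = ⟨s(σ i, σ j), hadj⟩ := rfl
    rw [h1, rigidityMap_mk, rigidityMap_mk, ← hw, ← hw, ← hp', ← hp', ← map_sub, ← map_sub,
      h.inner_map_map]
  have hrep : ∀ w e, rigidityMap d G p (average h σ w) (r e) =
      rigidityMap d G p (average h σ w) e := by
    intro w e
    rcases hr e with h1 | h1
    · rw [h1]
    · rw [h1, hsymm]
  let g : ({e // r e = e} → ℝ) →ₗ[ℝ] (G.edgeSet → ℝ) :=
    LinearMap.funLeft ℝ ℝ fun e => ⟨r e, hrr e⟩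
  have hle : LinearMap.range (rigidityMap d G p ∘ₗ average h σ) ≤ LinearMap.range g := by
    rintro _ ⟨w, rfl⟩
    exact ⟨fun e => rigidityMap d G p (average h σ w) e, funext fun e => hrep w e⟩
  calc _ ≤ finrank ℝ (LinearMap.range g) := Submodule.finrank_mono hle
    _ ≤ finrank ℝ ({e // r e = e} → ℝ) := LinearMap.finrank_range_le g
    _ = _ := by rw [finrank_fintype_fun_eq_card]

theorem hasDerivAt_norm_sq_sub [Fintype V] {γ : ℝ → V → Space d} {u : V → Space d} {t : ℝ}
    (hγ : HasDerivAt γ u t) (i j : V) :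
    HasDerivAt (fun s => ‖γ s i - γ s j‖ ^ 2) (2 * ⟪γ t i - γ t j, u i - u j⟫_ℝ) t := by
  rw [hasDerivAt_pi] at hγ
  exact ((hγ i).sub (hγ j)).norm_sq

open Set Filter Topology in
/-- At a generic realization, an infinitesimal motion preserving the symmetry which changes some
distance extends to a mechanism preserving the symmetry. -/
theorem hasSymmetryPreservingMechanism_of_infinitesimal [Fintype V] [DecidableEq V]
    (hh : IsHalfTurn h) (Φ : halfTurnGroup h →* (G ≃g G)) {p w : V → Space d}
    (hp : IsSymGeneric Φ p) (hw : average h (Φ (halfTurn h)) w = w)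
    (hpw : rigidityMap d G p w = 0) (hpw' : rigidityMap d ⊤ p w ≠ 0) :
    HasSymmetryPreservingMechanism Φ p := by
  classical
  set σ := Φ (halfTurn h) with hσdef
  have hσ : Function.Involutive σ := map_halfTurn_involutive hh Φ
  have hmem : ∀ q, average h σ q = q ↔ q ∈ symConfigs Φ := fun q => by
    rw [average_eq_self_iff hh.apply_apply, mem_symConfigs_iff hh]
  let B : (V → Space d) →L[ℝ] (V → Space d) →L[ℝ] (G.edgeSet → ℝ) :=
    LinearMap.toContinuousLinearMap
      ((LinearMap.toContinuousLinearMap (𝕜 := ℝ) (E := V → Space d)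
        (F' := G.edgeSet → ℝ)).toLinearMap ∘ₗ rigidityMap d G)
  obtain ⟨ε, hε, γ, hγ0, hγ', hγ⟩ := exists_curve_mem_ker_of_rank_le B
    (LinearMap.toContinuousLinearMap (average h σ)) (p := p) (w := w)
    (average_average hh.apply_apply hσ) ((hmem p).2 hp.1.2) hw
    (fun q u hq hu => rigidityMap_average_eq_zero hh.apply_apply
      (fun i j hij => σ.map_adj_iff.2 hij) hq hu)
    (fun q hq => by
      have := hp.rank_le G ((hmem q).1 hq)
      rw [← finrank_range_rigidityMap, ← finrank_range_rigidityMap] at this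
      exact this) hpw
  obtain ⟨k, l, hkl⟩ : ∃ k l, ⟪p k - p l, w k - w l⟫_ℝ ≠ 0 := by
    by_contra! hcon
    exact hpw' ((rigidityMap_eq_zero_iff _ _ _).2 fun i j _ => hcon i j)
  have hmain : ∀ᶠ t in 𝓝 (0 : ℝ), t ∈ Ioo (-ε) ε ∧ Function.Injective (γ t) ∧
      (t ≠ 0 → ‖γ t k - γ t l‖ ^ 2 ≠ ‖p k - p l‖ ^ 2) := by
    refine Eventually.and (Ioo_mem_nhds (neg_lt_zero.2 hε) hε) (Eventually.and ?_ ?_)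
    · have h1 : ∀ i j, ∀ᶠ t in 𝓝 (0 : ℝ), γ t i = γ t j → i = j := by
        intro i j
        by_cases hij : i = j
        · exact Eventually.of_forall fun _ _ => hij
        · have h2 : ContinuousAt (fun t => γ t i - γ t j) 0 := by
            have := hγ'.continuousAt
            exact ((continuous_apply i).continuousAt.comp this).sub
              ((continuous_apply j).continuousAt.comp this)
          have h3 : γ 0 i - γ 0 j ≠ 0 := by
            rw [hγ0, sub_ne_zero]; exact fun h => hij (hp.1.1 h)
          filter_upwards [h2.eventually_ne h3] with t ht h
          exact absurd (sub_eq_zero.2 h) ht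
      have h2 := eventually_all.2 fun i => eventually_all.2 (h1 i)
      filter_upwards [h2] with t ht i j using ht i j
    -- The squared distance has nonzero derivative at 0, so it avoids its initial value on a
    -- punctured neighbourhood.
    · have h1 := hasDerivAt_norm_sq_sub hγ' k l
      have h2 := h1.eventually_ne (c := ‖p k - p l‖ ^ 2)
        (mul_ne_zero two_ne_zero (by rw [hγ0]; exact hkl))
      exact eventually_nhdsWithin_iff.1 h2
  obtain ⟨δ, hδ, hδγ⟩ := Metric.eventually_nhds_iff.1 hmain
  have hscale : ∀ t : unitInterval, dist (δ / 2 * (t : ℝ)) 0 < δ := by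
    intro t
    rw [Real.dist_eq, sub_zero, abs_of_nonneg (mul_nonneg (by linarith) t.2.1)]
    nlinarith [t.2.2]
  refine ⟨fun t => γ (δ / 2 * t), ⟨?_, ?_, ?_, k, l, ?_⟩, fun t => ⟨?_, ?_⟩⟩
  · rw [continuous_iff_continuousAt]
    intro t
    obtain ⟨u, hu, -⟩ := (hγ _ (hδγ (hscale t)).1).2
    have h1 : ContinuousAt (fun t : unitInterval => δ / 2 * (t : ℝ)) t := by fun_prop
    exact ContinuousAt.comp (f := fun t : unitInterval => δ / 2 * (t : ℝ)) hu.continuousAt h1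
  · simp [hγ0]
  · intro t i j hij
    have hd : ∀ s ∈ Ioo (-ε) ε, HasDerivAt (fun s => ‖γ s i - γ s j‖ ^ 2) 0 s := by
      intro s hs
      obtain ⟨u, hu, hBu⟩ := (hγ s hs).2
      have h1 := hasDerivAt_norm_sq_sub hu i j
      rwa [(rigidityMap_eq_zero_iff G (γ s) u).1 hBu i j hij, mul_zero] at h1
    have h2 := isOpen_Ioo.is_const_of_deriv_eq_zero (isPreconnected_Ioo)
      (fun s hs => (hd s hs).differentiableAt.differentiableWithinAt)
      (fun s hs => (hd s hs).deriv) (hδγ (hscale t)).1 ⟨by linarith, hε⟩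
    simp only [hγ0] at h2
    exact (sq_eq_sq₀ (norm_nonneg _) (norm_nonneg _)).1 h2
  · intro t ht heq
    have ht' : (0 : ℝ) < t := ht
    exact (hδγ (hscale t)).2.2 (by positivity) (by rw [heq])
  · exact (hδγ (hscale t)).2.1
  · exact (hmem _).1 (hγ _ (hδγ (hscale t)).1).1

theorem card_mapEdgeSet_fixed [Fintype V] [DecidableEq V] [DecidableRel G.Adj]
    {S : Subgroup (Orth d)} (Φ : S →* (G ≃g G)) (x : S) :
    Fintype.card {e // (Φ x).mapEdgeSet e = e} = fixedBars Φ x := by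
  rw [fixedBars, ← Nat.card_coe_set_eq, ← Nat.card_eq_fintype_card]
  refine Nat.card_congr ((Equiv.subtypeEquivRight fun e => ?_).trans
    (Equiv.subtypeSubtypeEquivSubtypeInter _ fun e => Sym2.map (Φ x) e = e))
  exact Subtype.ext_iff

/-- The quantity in `hj` is four times the excess of symmetric velocities over edge orbits and rigid
motions; the number of vertices cancels. -/
theorem hasSymmetryPreservingMechanism_of_count [Fintype V] [DecidableEq V] [DecidableRel G.Adj]
    (hcount : (G.edgeFinset.card : ℤ) = d * (Fintype.card V : ℤ) - ((d + 1).choose 2 : ℤ))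
    (hd : 4 ≤ d) (hh : IsHalfTurn h) (Φ : halfTurnGroup h →* (G ≃g G))
    (hj : (0 : ℝ) < 2 * (d - 4) * fixedJoints Φ (halfTurn h) - 2 * fixedBars Φ (halfTurn h) -
      d * (d - 7) - 8)
    {p : V → Space d} (hp : IsSymGeneric Φ p) :
    HasSymmetryPreservingMechanism Φ p := by
  classical
  have hσ : Function.Involutive (Φ (halfTurn h)) := map_halfTurn_involutive hh Φ
  have hmem : ∀ q, average h (Φ (halfTurn h)) q = q ↔ q ∈ symConfigs Φ := fun q => by
    rw [average_eq_self_iff hh.apply_apply, mem_symConfigs_iff hh]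
  have hpP := (hmem p).2 hp.1.2
  by_contra hno
  -- Without a mechanism, every symmetric infinitesimal motion of `G` preserves all distances to
  -- first order, so the complete graph has no larger symmetric rank than `G`.
  have hker : LinearMap.ker (rigidityMap d G p ∘ₗ average h (Φ (halfTurn h))) ≤
      LinearMap.ker (rigidityMap d ⊤ p ∘ₗ average h (Φ (halfTurn h))) := by
    intro w hw
    by_contra hw'
    exact hno (hasSymmetryPreservingMechanism_of_infinitesimal hh Φ hp
      (average_average hh.apply_apply hσ w) hw hw')
  have hrank : finrank ℝ (LinearMap.range (rigidityMap d ⊤ p ∘ₗ average h (Φ (halfTurn h)))) ≤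
      finrank ℝ (LinearMap.range (rigidityMap d G p ∘ₗ average h (Φ (halfTurn h)))) := by
    have h1 := LinearMap.finrank_range_add_finrank_ker
      (rigidityMap d G p ∘ₗ average h (Φ (halfTurn h)))
    have h2 := LinearMap.finrank_range_add_finrank_ker
      (rigidityMap d ⊤ p ∘ₗ average h (Φ (halfTurn h)))
    have h3 := Submodule.finrank_mono hker
    omega
  have hτ : Function.Involutive (Φ (halfTurn h)).mapEdgeSet := by
    rintro ⟨e, he⟩
    induction e with | _ i j
    apply Subtype.ext
    change s(Φ (halfTurn h) (Φ (halfTurn h) i), Φ (halfTurn h) (Φ (halfTurn h) j)) = s(i, j)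
    rw [hσ, hσ]
  obtain ⟨r, hr1, hr2, hrc⟩ := hσ.exists_orbit_representative
  obtain ⟨rE, hrE1, hrE2, hrEc⟩ := hτ.exists_orbit_representative
  have hrr : ∀ i, r (r i) = r i := fun i => by
    rcases hr2 i with h1 | h1
    · rw [h1, h1]
    · rw [h1, hr1, h1]
  have hrrE : ∀ e, rE (rE e) = rE e := fun e => by
    rcases hrE2 e with h1 | h1
    · rw [h1, h1]
    · rw [h1, hrE1, h1]
  have hfixed : Fintype.card {i // Φ (halfTurn h) i = i} = fixedJoints Φ (halfTurn h) := by
    rw [fixedJoints, ← Nat.card_coe_set_eq, ← Nat.card_eq_fintype_card]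
    rfl
  have hpairs : Fintype.card {i // r i = i ∧ Φ (halfTurn h) i ≠ i} +
      Fintype.card {i // Φ (halfTurn h) i = i} = Fintype.card {i // r i = i} := by
    rw [Fintype.card_subtype, Fintype.card_subtype, Fintype.card_subtype,
      ← Finset.card_union_of_disjoint]
    · congr 1
      ext i
      simp only [Finset.mem_union, Finset.mem_filter, Finset.mem_univ, true_and]
      have : Φ (halfTurn h) i = i → r i = i := fun hi => (hr2 i).elim id fun h => h.trans hi
      tauto
    · rw [Finset.disjoint_filter]
      exact fun i _ hi => hi.2
  have hE : (Fintype.card G.edgeSet : ℝ) = d * Fintype.card V - (d + 1) * d / 2 := by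
    have h1 : (Fintype.card G.edgeSet : ℤ) = d * Fintype.card V - ((d + 1).choose 2 : ℤ) := by
      rw [← hcount, SimpleGraph.edgeFinset_card]
    have h2 : ((Fintype.card G.edgeSet : ℤ) : ℝ) =
      ((d * Fintype.card V - ((d + 1).choose 2 : ℤ) : ℤ) : ℝ) := by rw [h1]
    push_cast [Nat.cast_choose_two] at h2
    rw [h2]; ring
  obtain ⟨F, hFd, hF, hF'⟩ := id hh
  have hFd' : finrank ℝ Fᗮ = 2 := by
    have h1 := F.finrank_add_finrank_orthogonal
    rw [finrank_euclideanSpace_fin] at h1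
    omega
  -- With no vertices the prescribed edge count would be negative; a vertex is needed to supply the
  -- base orbit.
  have hne : Nonempty V := by
    by_contra hempty
    rw [not_nonempty_iff] at hempty
    rw [Fintype.card_eq_zero (α := V), Nat.cast_zero, mul_zero] at hE
    have h1 : (0 : ℝ) ≤ Fintype.card G.edgeSet := Nat.cast_nonneg _
    have h2 : (2 : ℝ) ≤ d := by exact_mod_cast (by omega : 2 ≤ d)
    nlinarith
  obtain ⟨i₀⟩ := hne
  obtain ⟨q, hq, hqrank⟩ := exists_symmetric_rank_ge hh.apply_apply hσ (D := d - 2) (by omega)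
    hFd' hF hF' hr1 hrr ⟨r i₀, hrr i₀⟩
  -- Genericity bounds the full rank; the block argument turns this into a bound for symmetric
  -- velocities.
  have hmax := finrank_range_comp_le_of_maximal (rigidityMap d (⊤ : SimpleGraph V))
    (average h (Φ (halfTurn h))) (average_average hh.apply_apply hσ)
    (fun q u hq hu => rigidityMap_average_eq_zero hh.apply_apply
      (fun i j hij => (hσ.injective.ne hij : _)) hq hu) hpP
    (fun q hq => by
      rw [finrank_range_rigidityMap, finrank_range_rigidityMap]
      exact hp.rank_le _ ((hmem q).1 hq)) hq
  have hle := finrank_range_rigidityMap_average_le hh.apply_apply _ hσ hpP hrrE hrE2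
  have htotal := hqrank.trans (Nat.add_le_add_right (hmax.trans (hrank.trans hle)) _)
  have hS := card_sigma_fin_mul_two (d - 2)
  have hS2 := card_sigma_fin_mul_two 2
  rw [card_mapEdgeSet_fixed] at hrEc
  rw [hfixed] at hrc hpairs
  rify at htotal hS hS2 hrc hrEc hpairs
  rw [Nat.cast_sub (by omega : 1 ≤ d - 2)] at hS
  rw [Nat.cast_sub (by omega : 2 ≤ d)] at hS htotal
  push_cast at hS htotal hS2
  have hR : (Fintype.card {i // r i = i} : ℝ) =
    (Fintype.card V + fixedJoints Φ (halfTurn h)) / 2 := by linarith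
  have hR' : (Fintype.card {i // r i = i ∧ Φ (halfTurn h) i ≠ i} : ℝ) =
    (Fintype.card V - fixedJoints Φ (halfTurn h)) / 2 := by linarith
  rw [hR, hR'] at htotal
  nlinarith

end

end SymFramework

theorem mainTheorem8 {V : Type*} [Fintype V] [DecidableEq V] (G : SimpleGraph V)
    [DecidableRel G.Adj] (d : ℕ)
    (hcount : (G.edgeFinset.card : ℤ) = d * (Fintype.card V : ℤ) - ((d + 1).choose 2 : ℤ))
    (h : SymFramework.Orth d) (hh : SymFramework.IsHalfTurn h)
    (Φ : SymFramework.halfTurnGroup h →* (G ≃g G)) :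
    (d = 4 → SymFramework.fixedBars Φ (SymFramework.halfTurn h) = 0 →
      ∀ p : V → SymFramework.Space d, SymFramework.IsSymGeneric Φ p →
        SymFramework.HasSymmetryPreservingMechanism Φ p) ∧
    (4 < d →
      (SymFramework.fixedJoints Φ (SymFramework.halfTurn h) : ℝ) >
        (SymFramework.fixedBars Φ (SymFramework.halfTurn h) : ℝ) / ((d : ℝ) - 4) +
          ((d : ℝ) * ((d : ℝ) - 7) + 8) / (2 * ((d : ℝ) - 4)) →
      ∀ p : V → SymFramework.Space d, SymFramework.IsSymGeneric Φ p →
        SymFramework.HasSymmetryPreservingMechanism Φ p) := by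
  refine ⟨fun hd hb p hp => ?_, fun hd hj p hp => ?_⟩
  · refine SymFramework.hasSymmetryPreservingMechanism_of_count hcount hd.ge hh Φ ?_ hp
    have hd' : (d : ℝ) = 4 := by exact_mod_cast hd
    rw [hb, hd']
    norm_num
  · refine SymFramework.hasSymmetryPreservingMechanism_of_count hcount hd.le hh Φ ?_ hp
    have hd' : (0 : ℝ) < d - 4 := sub_pos.2 (by exact_mod_cast hd)
    rw [gt_iff_lt, div_add_div _ _ hd'.ne' (by positivity), div_lt_iff₀ (by positivity)] at hj
    -- Adding the fractions leaves the denominator `(d - 4) * (2 * (d - 4))`; one factor `d - 4` is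
    -- cancelled.
    have h1 := lt_of_mul_lt_mul_left (a := (d : ℝ) - 4)
      (b := 2 * SymFramework.fixedBars Φ (SymFramework.halfTurn h) + (d * (d - 7) + 8))
      (c := 2 * (d - 4) * SymFramework.fixedJoints Φ (SymFramework.halfTurn h))
      (by linarith) hd'.le
    linarith
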